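/- Let $\Bbbk$ be a field of characteristic zero, and let $W_+$ be the positive Witt algebra over $\Bbbk$: the Lie algebra with $\Bbbk$-basis $\{e_n : n\in\mathbb{Z}_{\ge 1}\}$ and Lie bracket $[e_i,e_j]=(j-i)e_{i+j}$. Let $W_+$ act on its symmetric algebra $\mathrm{S}(W_+)$ by the derivations that extend the adjoint action, and let $\mathrm{S}^2(W_+)$ be the submodule of quadratic elements, that is, the span of the products $xy$ with $x,y\in W_+$. Then $\mathrm{S}^2(W_+)$ is a noetherian $W_+$-module: its $W_+$-submodules satisfy the ascending chain condition. -/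

import Mathlib

noncomputable section

/-- The positive Witt algebra `W₊` over `k`: the vector space with basis `e n`, `n ≥ 1`. -/
def PositiveWitt (k : Type*) [Field k] : Type _ := ℕ+ →₀ k

namespace PositiveWitt

variable {k : Type*} [Field k]

instance : AddCommGroup (PositiveWitt k) := inferInstanceAs (AddCommGroup (ℕ+ →₀ k))

instance : Module k (PositiveWitt k) := inferInstanceAs (Module k (ℕ+ →₀ k))

/-- The standard basis `e n`, `n ≥ 1`, of `W₊`. -/
def e : Module.Basis ℕ+ k (PositiveWitt k) := ⟨LinearEquiv.refl k (ℕ+ →₀ k)⟩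

/-- The bilinear map with `(e i, e j) ↦ (j - i) e (i + j)`. -/
def bracketMap : PositiveWitt k →ₗ[k] PositiveWitt k →ₗ[k] PositiveWitt k :=
  e.constr k fun i => e.constr k fun j => (((j : ℕ) : k) - ((i : ℕ) : k)) • e (i + j)

theorem bracketMap_e_e (i j : ℕ+) :
    bracketMap (e i : PositiveWitt k) (e j) = (((j : ℕ) : k) - ((i : ℕ) : k)) • e (i + j) := by
  simp [bracketMap, Module.Basis.constr_basis]

theorem bracketMap_skew (x y : PositiveWitt k) : bracketMap x y = -bracketMap y x := by
  have h : (bracketMap (k := k)) = -(bracketMap (k := k)).flip := by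
    refine e.ext fun i => e.ext fun j => ?_
    simp only [LinearMap.neg_apply, LinearMap.flip_apply, bracketMap_e_e, add_comm j i,
      ← neg_smul, neg_sub]
  exact congrArg (fun B => B x y) h

theorem induction_e {p : PositiveWitt k → Prop} (basis : ∀ i, p (e i)) (zero : p 0)
    (add : ∀ x y, p x → p y → p (x + y)) (smul : ∀ (t : k) x, p x → p (t • x))
    (x : PositiveWitt k) : p x := by
  have hx : x ∈ Submodule.span k (Set.range (e : ℕ+ → PositiveWitt k)) := by
    rw [e.span_eq]; trivial
  induction hx using Submodule.span_induction with
  | mem y hy => obtain ⟨i, rfl⟩ := hy; exact basis i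
  | zero => exact zero
  | add y z _ _ hy hz => exact add y z hy hz
  | smul t y _ hy => exact smul t y hy

theorem bracketMap_self (x : PositiveWitt k) : bracketMap x x = 0 := by
  induction x using induction_e with
  | basis i => simp [bracketMap_e_e]
  | zero => simp
  | add x y hx hy => simp [hx, hy, bracketMap_skew x y]
  | smul t x hx => simp [hx]

theorem bracketMap_leibniz (x y z : PositiveWitt k) :
    bracketMap x (bracketMap y z) =
      bracketMap (bracketMap x y) z + bracketMap y (bracketMap x z) := by
  induction x using induction_e with
  | zero => simp
  | add x x' hx hx' => simp only [map_add, LinearMap.add_apply, hx, hx']; abel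
  | smul t x hx => simp only [map_smul, LinearMap.smul_apply, hx, smul_add]
  | basis i =>
    induction y using induction_e with
    | zero => simp
    | add y y' hy hy' => simp only [map_add, LinearMap.add_apply, hy, hy']; abel
    | smul t y hy => simp only [map_smul, LinearMap.smul_apply, hy, smul_add]
    | basis j =>
      induction z using induction_e with
      | zero => simp
      | add z z' hz hz' => simp only [map_add, hz, hz']; abel
      | smul t z hz => simp only [map_smul, hz, smul_add]
      | basis l =>
        simp only [bracketMap_e_e, map_smul, LinearMap.smul_apply, smul_smul,
          add_left_comm j i l, ← add_assoc, ← add_smul, PNat.add_coe, Nat.cast_add]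
        congr 1
        ring

instance : LieRing (PositiveWitt k) where
  bracket x y := bracketMap x y
  add_lie x y z := by simp
  lie_add x y z := by simp
  lie_self x := bracketMap_self x
  leibniz_lie x y z := bracketMap_leibniz x y z

instance : LieAlgebra k (PositiveWitt k) where
  lie_smul t x y := (bracketMap x).map_smul t y

theorem lie_e_e (i j : ℕ+) :
    ⁅(e i : PositiveWitt k), (e j : PositiveWitt k)⁆ =
      (((j : ℕ) : k) - ((i : ℕ) : k)) • e (i + j) :=
  bracketMap_e_e i j

end PositiveWitt

namespace SymmetricAlgebra

section Derivation

variable {R M : Type*} [CommRing R] [AddCommGroup M] [Module R M]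

/-- The algebra map `a ↦ (a, D a)` into the square-zero extension which encodes the derivation
`D` of the symmetric algebra that extends a linear map `f` given on generators. -/
def derivHom (f : M →ₗ[R] SymmetricAlgebra R M) :
    SymmetricAlgebra R M →ₐ[R]
      TrivSqZeroExt (SymmetricAlgebra R M) (SymmetricAlgebra R M) :=
  lift ((TrivSqZeroExt.inlAlgHom R (SymmetricAlgebra R M)
      (SymmetricAlgebra R M)).toLinearMap ∘ₗ ι R M +
    (TrivSqZeroExt.inrHom (SymmetricAlgebra R M)
      (SymmetricAlgebra R M)).restrictScalars R ∘ₗ f)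

theorem fst_derivHom (f : M →ₗ[R] SymmetricAlgebra R M) (a : SymmetricAlgebra R M) :
    (derivHom f a).fst = a := by
  have h : (TrivSqZeroExt.fstHom R (SymmetricAlgebra R M) (SymmetricAlgebra R M)).comp
      (derivHom f) = AlgHom.id R (SymmetricAlgebra R M) := by
    apply algHom_ext
    ext x
    simp [derivHom]
  exact congrArg (fun F => F a) h

/-- The unique derivation of the symmetric algebra extending a linear map on generators. -/
def deriv (f : M →ₗ[R] SymmetricAlgebra R M) :
    Derivation R (SymmetricAlgebra R M) (SymmetricAlgebra R M) :=
  Derivation.mk' ((TrivSqZeroExt.sndHom (SymmetricAlgebra R M)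
      (SymmetricAlgebra R M)).restrictScalars R ∘ₗ (derivHom f).toLinearMap) (by
    intro a b
    simp [fst_derivHom, mul_comm])

theorem deriv_ι (f : M →ₗ[R] SymmetricAlgebra R M) (x : M) : deriv f (ι R M x) = f x := by
  simp [deriv, derivHom]

theorem derivation_ext {D E : Derivation R (SymmetricAlgebra R M) (SymmetricAlgebra R M)}
    (h : ∀ x, D (ι R M x) = E (ι R M x)) : D = E := by
  ext a
  induction a using SymmetricAlgebra.induction with
  | algebraMap r => simp
  | ι x => exact h x
  | mul a b ha hb => simp [ha, hb]
  | add a b ha hb => simp [ha, hb]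

end Derivation

section Lie

variable (R L : Type*) [CommRing R] [LieRing L] [LieAlgebra R L]

/-- The action of a Lie algebra `L` on its symmetric algebra: `x : L` acts as the derivation
`{x, -}` that extends `ad x`. -/
def lieAction : L →ₗ⁅R⁆ Derivation R (SymmetricAlgebra R L) (SymmetricAlgebra R L) where
  toFun x := deriv (ι R L ∘ₗ (LieAlgebra.ad R L x : L →ₗ[R] L))
  map_add' x y := derivation_ext fun z => by simp [deriv_ι]
  map_smul' t x := derivation_ext fun z => by simp [deriv_ι]
  map_lie' {x y} := derivation_ext fun z => by
    simp [deriv_ι, Derivation.commutator_apply]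

instance instLieRingModule : LieRingModule L (SymmetricAlgebra R L) where
  bracket x a := lieAction R L x a
  add_lie x y a := by simp
  lie_add x a b := by simp
  leibniz_lie x y a := by
    rw [LieHom.map_lie, Derivation.commutator_apply, sub_add_cancel]

instance instLieModule : LieModule R L (SymmetricAlgebra R L) where
  smul_lie t x a :=
    congrArg (fun D : Derivation R _ _ => D a) ((lieAction R L).map_smul t x)
  lie_smul t x a := (lieAction R L x).map_smul t a

theorem lie_ι (x y : L) : ⁅x, ι R L y⁆ = ι R L ⁅x, y⁆ := deriv_ι _ _

theorem lie_mul (x : L) (a b : SymmetricAlgebra R L) : ⁅x, a * b⁆ = a * ⁅x, b⁆ + b * ⁅x, a⁆ :=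
  (lieAction R L x).leibniz a b

/-- The `n`-th symmetric power `Sⁿ(L)`, spanned by the products of `n` elements of `L`
in the symmetric algebra, as an `L`-submodule. -/
def symPow (n : ℕ) : LieSubmodule R L (SymmetricAlgebra R L) where
  __ := (LinearMap.range (ι R L)) ^ n
  lie_mem {x a} ha := by
    change ⁅x, a⁆ ∈ (LinearMap.range (ι R L)) ^ n
    change a ∈ (LinearMap.range (ι R L)) ^ n at ha
    induction ha using Submodule.pow_induction_on_left' with
    | algebraMap r =>
      have h : ⁅x, algebraMap R (SymmetricAlgebra R L) r⁆ = 0 :=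
        (lieAction R L x).map_algebraMap r
      rw [h]
      exact Submodule.zero_mem _
    | add a b i _ _ ha hb => rw [lie_add]; exact Submodule.add_mem _ ha hb
    | mem_mul m hm i a hmem ha =>
      obtain ⟨y, rfl⟩ := hm
      rw [lie_mul, lie_ι, pow_succ', mul_comm a]
      exact Submodule.add_mem _ (Submodule.mul_mem_mul ⟨y, rfl⟩ ha)
        (Submodule.mul_mem_mul ⟨⁅x, y⁆, rfl⟩ hmem)

end Lie

end SymmetricAlgebra

end

noncomputable section

namespace WittPoly

section OneVariable

open Polynomial

variable {k : Type*} [Field k]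

theorem coeff_X_pow_mul_derivative_add (n i : ℕ) (t : k) (v : k[X]) :
    (X ^ (n + 2) * derivative v + C t * X ^ (n + 1) * v).coeff (i + (n + 1)) =
      ((i : k) + t) * v.coeff i := by
  have h : X ^ (n + 2) * derivative v + C t * X ^ (n + 1) * v =
      X ^ (n + 1) * (X * derivative v + C t * v) := by ring
  rw [h, coeff_X_pow_mul, coeff_add, coeff_C_mul, add_mul]
  congr 1
  cases i with
  | zero => simp
  | succ i => rw [coeff_X_mul, coeff_derivative]; push_cast; ring

/-- A nonzero subspace of `k[t]` closed under the operators `t ^ (n + 2) * d/dt + κ n * t ^ (n + 1)`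
has finite codimension, if these operators are injective in high degree on leading terms. -/
theorem exists_sup_degreeLT_eq_top (κ : ℕ → k)
    (hκ : ∀ d : ℕ, ∃ m, ∀ n ≥ m, (d : k) + κ n ≠ 0) (V : Submodule k k[X])
    (hV : ∀ n, ∀ v ∈ V, X ^ (n + 2) * derivative v + C (κ n) * X ^ (n + 1) * v ∈ V)
    {v : k[X]} (hv : v ∈ V) (hv0 : v ≠ 0) : ∃ D, V ⊔ degreeLT k D = ⊤ := by
  obtain ⟨m, hm⟩ := hκ v.natDegree
  refine ⟨v.natDegree + m + 1, ?_⟩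
  have hex : ∀ j ≥ v.natDegree + m + 1, ∃ w ∈ V, w.coeff j ≠ 0 ∧ ∀ i > j, w.coeff i = 0 := by
    intro j hj
    obtain ⟨n, hn, rfl⟩ : ∃ n ≥ m, j = v.natDegree + (n + 1) := ⟨j - v.natDegree - 1, by omega,
      by omega⟩
    refine ⟨_, hV n v hv, ?_, fun i hi => ?_⟩
    · rw [coeff_X_pow_mul_derivative_add]
      exact mul_ne_zero (hm n hn) (leadingCoeff_ne_zero.2 hv0)
    · obtain ⟨l, rfl⟩ : ∃ l, i = l + (n + 1) := ⟨i - (n + 1), by omega⟩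
      rw [coeff_X_pow_mul_derivative_add, coeff_eq_zero_of_natDegree_lt (by omega), mul_zero]
  have hle : ∀ j, degreeLT k j ≤ V ⊔ degreeLT k (v.natDegree + m + 1) := by
    intro j
    induction j with
    | zero => exact (degreeLT_mono (Nat.zero_le _)).trans le_sup_right
    | succ j ih =>
      by_cases hj : v.natDegree + m + 1 ≤ j
      · intro q hq
        obtain ⟨w, hw, hw0, hw1⟩ := hex j hj
        have hsub : q - (q.coeff j / w.coeff j) • w ∈ degreeLT k j := by
          rw [mem_degreeLT, degree_lt_iff_coeff_zero] at hq ⊢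
          intro i hi
          rw [coeff_sub, coeff_smul, smul_eq_mul]
          rcases hi.eq_or_lt with rfl | hi
          · rw [div_mul_cancel₀ _ hw0, sub_self]
          · rw [hq i hi, hw1 i hi, mul_zero, sub_zero]
        have := Submodule.add_mem _ (ih hsub)
          (Submodule.mem_sup_left (Submodule.smul_mem V (q.coeff j / w.coeff j) hw))
        rwa [sub_add_cancel] at this
      · exact (degreeLT_mono (by omega)).trans le_sup_right
  rw [eq_top_iff]
  intro q _
  exact hle (q.natDegree + 1)
    (mem_degreeLT.2 (degree_le_natDegree.trans_lt (by exact_mod_cast Nat.lt_succ_self _)))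

end OneVariable

open MvPolynomial

variable {k : Type*} [Field k]

/-- The operator on `k[x, y]` by which `e (n + 1)` acts on `S²(W₊)`, when `x ^ a * y ^ b` stands for
`e (a + 1) * e (b + 1)`. -/
def wittOp (n : ℕ) (h : MvPolynomial (Fin 2) k) : MvPolynomial (Fin 2) k :=
  X 0 ^ 2 * (X 0 ^ n * pderiv 0 h - pderiv 0 (X 0 ^ n) * h) +
    X 1 ^ 2 * (X 1 ^ n * pderiv 1 h - pderiv 1 (X 1 ^ n) * h)

theorem pderiv_comm (h : MvPolynomial (Fin 2) k) :
    pderiv 1 (pderiv 0 h) = pderiv 0 (pderiv 1 h) := by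
  have : ⁅pderiv (R := k) (1 : Fin 2), pderiv (R := k) (0 : Fin 2)⁆ = 0 := by
    apply MvPolynomial.derivation_ext
    intro i
    fin_cases i <;> simp [Derivation.commutator_apply]
  have := congrArg (fun D => D h) this
  simpa [Derivation.commutator_apply, sub_eq_zero] using this

theorem pderiv_zero_X_one_pow (n : ℕ) :
    pderiv (R := k) (0 : Fin 2) (X 1 ^ n : MvPolynomial (Fin 2) k) = 0 := by
  simp [Derivation.leibniz_pow]

theorem pderiv_one_X_zero_pow (n : ℕ) :
    pderiv (R := k) (1 : Fin 2) (X 0 ^ n : MvPolynomial (Fin 2) k) = 0 := by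
  simp [Derivation.leibniz_pow]

theorem pderiv_zero_X_one : pderiv (R := k) (0 : Fin 2) (X 1 : MvPolynomial (Fin 2) k) = 0 :=
  pderiv_X_of_ne (by decide)

theorem pderiv_one_X_zero : pderiv (R := k) (1 : Fin 2) (X 0 : MvPolynomial (Fin 2) k) = 0 :=
  pderiv_X_of_ne (by decide)

/-- The mixed part of a second-order operator, with symbol `Φ`. -/
def crossOp (Φ q : MvPolynomial (Fin 2) k) : MvPolynomial (Fin 2) k :=
  X 0 ^ 2 * X 1 ^ 2 * (Φ * pderiv 0 (pderiv 1 q) - pderiv 0 Φ * pderiv 1 q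
    - pderiv 1 Φ * pderiv 0 q + pderiv 0 (pderiv 1 Φ) * q)

set_option maxHeartbeats 1000000 in
theorem sum_wittOp_wittOp (i j : ℕ) (q : MvPolynomial (Fin 2) k) :
    wittOp (i + 4) (wittOp j q) - 4 * wittOp (i + 3) (wittOp (j + 1) q)
      + 6 * wittOp (i + 2) (wittOp (j + 2) q) - 4 * wittOp (i + 1) (wittOp (j + 3) q)
      + wittOp i (wittOp (j + 4) q) =
    crossOp ((X 0 - X 1) ^ 4 * (X 0 ^ i * X 1 ^ j + X 1 ^ i * X 0 ^ j)) q := by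
  have a1 := pderiv_zero_X_one_pow (k := k) i
  have a2 := pderiv_zero_X_one_pow (k := k) j
  have a3 := pderiv_one_X_zero_pow (k := k) i
  have a4 := pderiv_one_X_zero_pow (k := k) j
  have b2 : pderiv 1 (pderiv 0 (X 0 ^ j : MvPolynomial (Fin 2) k)) = 0 := by
    rw [pderiv_comm, a4, map_zero]
  have b3 : pderiv 0 (pderiv 1 (X 1 ^ i : MvPolynomial (Fin 2) k)) = 0 := by
    rw [← pderiv_comm, a1, map_zero]
  have b4 : pderiv 0 (pderiv 1 (X 1 ^ j : MvPolynomial (Fin 2) k)) = 0 := by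
    rw [← pderiv_comm, a2, map_zero]
  have c := pderiv_comm q
  simp only [wittOp, crossOp, pow_add _ i, pow_add _ j]
  generalize (X 0 : MvPolynomial (Fin 2) k) ^ i = u at *
  generalize (X 0 : MvPolynomial (Fin 2) k) ^ j = v at *
  generalize (X 1 : MvPolynomial (Fin 2) k) ^ i = u' at *
  generalize (X 1 : MvPolynomial (Fin 2) k) ^ j = v' at *
  simp only [pow_succ, pow_zero, one_mul, Derivation.leibniz, map_add, map_sub, pderiv_X_self,
    pderiv_zero_X_one, pderiv_one_X_zero, smul_eq_mul, a1, a2, a3, a4, b2, b3, b4, c, map_zero,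
    Derivation.map_one_eq_zero, mul_zero, add_zero, zero_add, mul_one]
  ring

theorem crossOp_mul (α Φ q : MvPolynomial (Fin 2) k) :
    crossOp (α * Φ) q = α * crossOp Φ q
      + pderiv 0 α * (X 0 ^ 2 * X 1 ^ 2 * (pderiv 1 Φ * q - Φ * pderiv 1 q))
      + pderiv 1 α * (X 0 ^ 2 * X 1 ^ 2 * (pderiv 0 Φ * q - Φ * pderiv 0 q))
      + pderiv 0 (pderiv 1 α) * (X 0 ^ 2 * X 1 ^ 2 * (Φ * q)) := by
  simp only [crossOp, Derivation.leibniz, map_add, smul_eq_mul, ← pderiv_comm]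
  simp only [pderiv_comm]
  ring

set_option maxHeartbeats 1000000 in
theorem sum_crossOp_crossOp (Φ Ψ q : MvPolynomial (Fin 2) k) :
    crossOp ((X 0 + X 1) ^ 4 * Φ) (crossOp Ψ q)
      - 4 * crossOp ((X 0 + X 1) ^ 3 * Φ) (crossOp ((X 0 + X 1) * Ψ) q)
      + 6 * crossOp ((X 0 + X 1) ^ 2 * Φ) (crossOp ((X 0 + X 1) ^ 2 * Ψ) q)
      - 4 * crossOp ((X 0 + X 1) * Φ) (crossOp ((X 0 + X 1) ^ 3 * Ψ) q)
      + crossOp Φ (crossOp ((X 0 + X 1) ^ 4 * Ψ) q) =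
    96 * (X 0 ^ 4 * X 1 ^ 4 * Φ * Ψ * q) := by
  simp only [crossOp_mul _ Ψ]
  have hA : ∃ A, A = X 0 ^ 2 * X 1 ^ 2 * (Ψ * q) := ⟨_, rfl⟩
  obtain ⟨A, hA⟩ := hA
  have hR : 96 * (X 0 ^ 4 * X 1 ^ 4 * Φ * Ψ * q) = 96 * (X 0 ^ 2 * X 1 ^ 2 * Φ * A) := by
    rw [hA]; ring
  rw [hR, ← hA]
  generalize crossOp Ψ q = B
  generalize X 0 ^ 2 * X 1 ^ 2 * (pderiv 1 Ψ * q - Ψ * pderiv 1 q) = C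
  generalize X 0 ^ 2 * X 1 ^ 2 * (pderiv 0 Ψ * q - Ψ * pderiv 0 q) = D
  have hs : pderiv 0 (X 0 + X 1 : MvPolynomial (Fin 2) k) = 1 := by simp
  have hs' : pderiv 1 (X 0 + X 1 : MvPolynomial (Fin 2) k) = 1 := by simp
  generalize (X 0 + X 1 : MvPolynomial (Fin 2) k) = s at *
  simp only [crossOp, pow_succ, pow_zero, one_mul, Derivation.leibniz, map_add, hs, hs',
    smul_eq_mul, map_zero, Derivation.map_one_eq_zero, mul_zero, add_zero, zero_add, mul_one]
  ring

theorem wittOp_add (n : ℕ) (p q : MvPolynomial (Fin 2) k) :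
    wittOp n (p + q) = wittOp n p + wittOp n q := by
  simp only [wittOp, map_add]; ring

theorem wittOp_smul (n : ℕ) (t : k) (p : MvPolynomial (Fin 2) k) :
    wittOp n (t • p) = t • wittOp n p := by
  simp only [wittOp, smul_eq_C_mul, pderiv_C_mul]; ring

theorem crossOp_add_left (Φ Φ' q : MvPolynomial (Fin 2) k) :
    crossOp (Φ + Φ') q = crossOp Φ q + crossOp Φ' q := by
  simp only [crossOp, map_add]; ring

theorem crossOp_smul_left (t : k) (Φ q : MvPolynomial (Fin 2) k) :
    crossOp (t • Φ) q = t • crossOp Φ q := by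
  simp only [crossOp, smul_eq_C_mul, pderiv_C_mul]; ring

/-- The subspaces of `k[x, y]` preserved by the action of the positive Witt algebra. -/
def IsStable (N : Submodule k (MvPolynomial (Fin 2) k)) : Prop :=
  ∀ n, ∀ h ∈ N, wittOp n h ∈ N

theorem IsStable.inf {N N' : Submodule k (MvPolynomial (Fin 2) k)} (hN : IsStable N)
    (hN' : IsStable N') : IsStable (N ⊓ N') :=
  fun n h hh => ⟨hN n h hh.1, hN' n h hh.2⟩

theorem IsStable.sup {N N' : Submodule k (MvPolynomial (Fin 2) k)} (hN : IsStable N)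
    (hN' : IsStable N') : IsStable (N ⊔ N') := by
  intro n h hh
  obtain ⟨p, hp, q, hq, rfl⟩ := Submodule.mem_sup.1 hh
  rw [wittOp_add]
  exact Submodule.add_mem_sup (hN n p hp) (hN' n q hq)

/-- The exchange of the two variables. -/
def swapVars : MvPolynomial (Fin 2) k →ₐ[k] MvPolynomial (Fin 2) k := aeval ![X 1, X 0]

@[simp]
theorem swapVars_X_zero : swapVars (X 0 : MvPolynomial (Fin 2) k) = X 1 := by simp [swapVars]

@[simp]
theorem swapVars_X_one : swapVars (X 1 : MvPolynomial (Fin 2) k) = X 0 := by simp [swapVars]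

@[simp]
theorem swapVars_swapVars (h : MvPolynomial (Fin 2) k) : swapVars (swapVars h) = h := by
  have : (swapVars (k := k)).comp swapVars = AlgHom.id k _ := by
    apply algHom_ext
    intro i
    fin_cases i <;> simp
  exact congrArg (fun F => F h) this

theorem monomial_eq_smul_X_pow (u : Fin 2 →₀ ℕ) (a : k) :
    monomial u a = a • (X 0 ^ u 0 * X 1 ^ u 1 : MvPolynomial (Fin 2) k) := by
  rw [monomial_eq, Finsupp.prod_fintype _ _ (by simp), Fin.prod_univ_two, smul_eq_C_mul]

theorem IsStable.crossOp_mem_of_symmetrized {N : Submodule k (MvPolynomial (Fin 2) k)}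
    (hN : IsStable N) (h : MvPolynomial (Fin 2) k) {q : MvPolynomial (Fin 2) k} (hq : q ∈ N) :
    crossOp ((X 0 - X 1) ^ 4 * (h + swapVars h)) q ∈ N := by
  induction h using MvPolynomial.induction_on' with
  | monomial u a =>
    have key := sum_wittOp_wittOp (u 0) (u 1) q
    have hw : ∀ i j, wittOp i (wittOp j q) ∈ N := fun i j => hN i _ (hN j _ hq)
    have hnat : ∀ (n : ℕ) {p}, p ∈ N → (n : MvPolynomial (Fin 2) k) * p ∈ N := by
      intro n p hp
      rw [← nsmul_eq_mul]
      exact N.nsmul_mem hp n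
    have hmem : crossOp ((X 0 - X 1) ^ 4 *
        (X 0 ^ u 0 * X 1 ^ u 1 + X 1 ^ u 0 * X 0 ^ u 1)) q ∈ N := by
      rw [← key]
      exact N.add_mem (N.sub_mem (N.add_mem (N.sub_mem (hw _ _) (hnat 4 (hw _ _)))
        (hnat 6 (hw _ _))) (hnat 4 (hw _ _))) (hw _ _)
    have : (X 0 - X 1) ^ 4 * (monomial u a + swapVars (monomial u a)) =
        a • ((X 0 - X 1) ^ 4 * (X 0 ^ u 0 * X 1 ^ u 1 + X 1 ^ u 0 * X 0 ^ u 1)) := by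
      rw [monomial_eq_smul_X_pow, map_smul, map_mul, map_pow, map_pow, swapVars_X_zero,
        swapVars_X_one, ← smul_add, mul_smul_comm]
    rw [this, crossOp_smul_left]
    exact N.smul_mem a hmem
  | add p p' hp hp' =>
    have : (X 0 - X 1) ^ 4 * (p + p' + swapVars (p + p')) =
        (X 0 - X 1) ^ 4 * (p + swapVars p) + (X 0 - X 1) ^ 4 * (p' + swapVars p') := by
      rw [map_add]; ring
    rw [this, crossOp_add_left]
    exact N.add_mem hp hp'

section CharZero

variable [CharZero k]

theorem half_smul_add_self (h : MvPolynomial (Fin 2) k) : (2⁻¹ : k) • (h + h) = h := by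
  rw [← two_smul k h, smul_smul, inv_mul_cancel₀ two_ne_zero, one_smul]

theorem IsStable.crossOp_mem {N : Submodule k (MvPolynomial (Fin 2) k)}
    (hN : IsStable N) {h : MvPolynomial (Fin 2) k} (hh : swapVars h = h)
    {q : MvPolynomial (Fin 2) k} (hq : q ∈ N) :
    crossOp ((X 0 - X 1) ^ 4 * h) q ∈ N := by
  have := hN.crossOp_mem_of_symmetrized ((2⁻¹ : k) • h) hq
  rwa [map_smul, hh, ← smul_add, half_smul_add_self] at this

theorem IsStable.mul_mem {N : Submodule k (MvPolynomial (Fin 2) k)}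
    (hN : IsStable N) {h : MvPolynomial (Fin 2) k} (hh : swapVars h = h)
    {q : MvPolynomial (Fin 2) k} (hq : q ∈ N) :
    X 0 ^ 4 * X 1 ^ 4 * (X 0 - X 1) ^ 8 * h * q ∈ N := by
  have key := sum_crossOp_crossOp ((X 0 - X 1) ^ 4 * h) ((X 0 - X 1) ^ 4) q
  have hs : swapVars (X 0 + X 1 : MvPolynomial (Fin 2) k) = X 0 + X 1 := by
    simp [add_comm]
  have h1 : ∀ i {p}, p ∈ N → crossOp ((X 0 + X 1) ^ i * ((X 0 - X 1) ^ 4 * h)) p ∈ N := by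
    intro i p hp
    rw [mul_left_comm]
    exact hN.crossOp_mem (by rw [map_mul, map_pow, hs, hh]) hp
  have h2 : ∀ i, crossOp ((X 0 + X 1) ^ i * (X 0 - X 1) ^ 4) q ∈ N := by
    intro i
    rw [mul_comm]
    exact hN.crossOp_mem (by rw [map_pow, hs]) hq
  have hnat : ∀ (n : ℕ) {p}, p ∈ N → (n : MvPolynomial (Fin 2) k) * p ∈ N := by
    intro n p hp
    rw [← nsmul_eq_mul]
    exact N.nsmul_mem hp n
  have hw : ∀ i j, crossOp ((X 0 + X 1) ^ i * ((X 0 - X 1) ^ 4 * h))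
      (crossOp ((X 0 + X 1) ^ j * (X 0 - X 1) ^ 4) q) ∈ N := fun i j => h1 i (h2 j)
  have h40 := hw 4 0
  have h31 := hw 3 1
  have h22 := hw 2 2
  have h13 := hw 1 3
  have h04 := hw 0 4
  simp only [pow_zero, pow_one, one_mul] at h40 h31 h13 h04
  have hmem := N.add_mem (N.sub_mem (N.add_mem (N.sub_mem h40 (hnat 4 h31))
    (hnat 6 h22)) (hnat 4 h13)) h04
  simp only [Nat.cast_ofNat] at hmem
  rw [key] at hmem
  have h96 : (96 : MvPolynomial (Fin 2) k) = C 96 := (map_ofNat C 96).symm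
  rw [h96, ← smul_eq_C_mul] at hmem
  have := (N.smul_mem_iff (by norm_num : (96 : k) ≠ 0)).1 hmem
  convert this using 1
  ring

theorem IsStable.mul_mem_of_symmetric {N : Submodule k (MvPolynomial (Fin 2) k)}
    (hN : IsStable N) (hanti : ∀ h, h - swapVars h ∈ N) {q : MvPolynomial (Fin 2) k}
    (hq : q ∈ N) (hsymm : swapVars q = q) (h : MvPolynomial (Fin 2) k) :
    X 0 ^ 4 * X 1 ^ 4 * (X 0 - X 1) ^ 8 * h * q ∈ N := by
  have h1 := hN.mul_mem (h := h + swapVars h) (by simp [add_comm]) hq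
  have h2 := hanti (X 0 ^ 4 * X 1 ^ 4 * (X 0 - X 1) ^ 8 * h * q)
  have h3 := N.smul_mem (2⁻¹ : k) (N.add_mem h1 h2)
  convert h3 using 1
  simp only [map_mul, map_pow, map_sub, swapVars_X_zero, swapVars_X_one, hsymm]
  refine (half_smul_add_self _).symm.trans ?_
  congr 1
  ring

end CharZero

/-- An ideal of a polynomial ring over a field of characteristic zero that is closed under the
partial derivatives is trivial. -/
theorem one_mem_of_pderiv_mem {σ : Type*} [CharZero k] (J : Ideal (MvPolynomial σ k))
    (hJ : ∀ i, ∀ q ∈ J, pderiv i q ∈ J) {q : MvPolynomial σ k} (hq : q ∈ J) (hq0 : q ≠ 0) :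
    (1 : MvPolynomial σ k) ∈ J := by
  classical
  induction hd : q.totalDegree using Nat.strong_induction_on generalizing q with
  | _ d ih =>
    obtain ⟨u, hu, hmax⟩ := Finset.exists_max_image q.support (fun u => u.degree)
      (support_nonempty.2 hq0)
    have hdeg : ∀ v ∈ q.support, v.degree ≤ q.totalDegree := by
      intro v hv
      exact le_totalDegree hv
    by_cases h0 : u = 0
    · have hC : q = C (q.coeff 0) := by
        rw [← totalDegree_eq_zero_iff_eq_C, totalDegree_eq_zero_iff]
        intro m hm x
        have := hmax m hm
        rw [h0, map_zero, Nat.le_zero, Finsupp.degree_eq_zero_iff] at this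
        simp [this]
      have hc : q.coeff 0 ≠ 0 := by
        intro h
        rw [h, map_zero] at hC
        exact hq0 hC
      have := J.mul_mem_left (C (q.coeff 0)⁻¹) hq
      rw [hC, coeff_C, if_pos rfl, ← C_mul, inv_mul_cancel₀ hc, C_1] at this
      exact this
    · obtain ⟨i, hi⟩ := Finsupp.ne_iff.1 h0
      have hi' : u - Finsupp.single i 1 + Finsupp.single i 1 = u :=
        Finsupp.sub_add_single_one_cancel hi
      have hne : pderiv i q ≠ 0 := by
        intro h
        have := congrArg (coeff (u - Finsupp.single i 1)) h
        rw [coeff_pderiv, hi', coeff_zero] at this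
        rcases mul_eq_zero.1 this with h | h
        · exact mem_support_iff.1 hu h
        · exact Nat.cast_add_one_ne_zero _ h
      refine ih _ ?_ (hJ i q hq) hne rfl
      obtain ⟨v, hv, hvd⟩ := Finset.exists_max_image (pderiv i q).support (fun u => u.degree)
        (support_nonempty.2 hne)
      have hv' : v + Finsupp.single i 1 ∈ q.support := by
        rw [mem_support_iff] at hv ⊢
        rw [coeff_pderiv] at hv
        exact left_ne_zero_of_mul hv
      have h1 : (pderiv i q).totalDegree ≤ v.degree := Finset.sup_le hvd
      have h2 := hdeg _ hv'
      rw [map_add, Finsupp.degree_single] at h2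
      omega

theorem X_mul_pderiv_X_pow {σ : Type*} (i : σ) (a : ℕ) :
    X i * pderiv i (X i ^ a) = (a : MvPolynomial σ k) * X i ^ a := by
  cases a with
  | zero => simp
  | succ a => rw [pderiv_pow, pderiv_X_self, Nat.add_sub_cancel, pow_succ]; ring

/-- The factor by which the `n`-th Witt operator on `k[x, y]` differs from a vector field, after
conjugation by `x ^ a * y ^ b * (x - y) ^ c`. -/
def twist (a b c n : ℕ) : MvPolynomial (Fin 2) k :=
  (a : MvPolynomial (Fin 2) k) * X 0 ^ (n + 1) + (b : MvPolynomial (Fin 2) k) * X 1 ^ (n + 1)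
    + (c : MvPolynomial (Fin 2) k) * ∑ i ∈ Finset.range (n + 2), X 0 ^ i * X 1 ^ (n + 1 - i)
    - (n : MvPolynomial (Fin 2) k) * (X 0 ^ (n + 1) + X 1 ^ (n + 1))

theorem wittOp_mul (a b c n : ℕ) (h : MvPolynomial (Fin 2) k) :
    wittOp n (X 0 ^ a * X 1 ^ b * (X 0 - X 1) ^ c * h) =
      X 0 ^ a * X 1 ^ b * (X 0 - X 1) ^ c *
        (X 0 ^ (n + 2) * pderiv 0 h + X 1 ^ (n + 2) * pderiv 1 h + twist a b c n * h) := by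
  have hS : (∑ i ∈ Finset.range (n + 2), X 0 ^ i * X 1 ^ (n + 1 - i)) * (X 0 - X 1) =
      (X 0 ^ (n + 2) - X 1 ^ (n + 2) : MvPolynomial (Fin 2) k) :=
    (Commute.all _ _).geom_sum₂_mul (n + 2)
  have hx := X_mul_pderiv_X_pow (k := k) (0 : Fin 2) a
  have hy := X_mul_pderiv_X_pow (k := k) (1 : Fin 2) b
  have hxn := X_mul_pderiv_X_pow (k := k) (0 : Fin 2) n
  have hyn := X_mul_pderiv_X_pow (k := k) (1 : Fin 2) n
  have hd : pderiv 1 ((X 0 - X 1) ^ c : MvPolynomial (Fin 2) k) =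
      - pderiv 0 ((X 0 - X 1) ^ c) := by
    simp
  have hd' : (X 0 - X 1) * pderiv 0 ((X 0 - X 1) ^ c) =
      (c : MvPolynomial (Fin 2) k) * (X 0 - X 1) ^ c := by
    cases c with
    | zero => simp
    | succ c =>
      rw [pderiv_pow, Nat.add_sub_cancel, map_sub, pderiv_X_self, pderiv_zero_X_one, pow_succ]
      ring
  simp only [wittOp, twist, Derivation.leibniz, smul_eq_mul, pderiv_zero_X_one_pow,
    pderiv_one_X_zero_pow, hd, mul_zero, add_zero, zero_add]
  generalize (∑ i ∈ Finset.range (n + 2), X 0 ^ i * X 1 ^ (n + 1 - i) :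
    MvPolynomial (Fin 2) k) = S at *
  generalize pderiv 0 ((X 0 - X 1) ^ c : MvPolynomial (Fin 2) k) = d at *
  generalize ((X 0 - X 1) ^ c : MvPolynomial (Fin 2) k) = e at *
  generalize pderiv 0 (X 0 ^ a : MvPolynomial (Fin 2) k) = xa' at *
  generalize pderiv 1 (X 1 ^ b : MvPolynomial (Fin 2) k) = yb' at *
  generalize pderiv 0 (X 0 ^ n : MvPolynomial (Fin 2) k) = xn' at *
  generalize pderiv 1 (X 1 ^ n : MvPolynomial (Fin 2) k) = yn' at *
  linear_combination X 0 ^ (n + 1) * X 1 ^ b * e * h * hx + X 1 ^ (n + 1) * X 0 ^ a * e * h * hy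
    - X 0 * X 0 ^ a * X 1 ^ b * e * h * hxn - X 1 * X 0 ^ a * X 1 ^ b * e * h * hyn
    + X 0 ^ a * X 1 ^ b * h * S * hd' - X 0 ^ a * X 1 ^ b * h * d * hS

/-- The ideal of multiples of `g`, as a subspace. -/
abbrev multiples (g : MvPolynomial (Fin 2) k) : Submodule k (MvPolynomial (Fin 2) k) :=
  (Ideal.span {g}).restrictScalars k

theorem mem_multiples {g h : MvPolynomial (Fin 2) k} : h ∈ multiples g ↔ g ∣ h :=
  Ideal.mem_span_singleton

theorem isStable_multiples (a b c : ℕ) :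
    IsStable (multiples (X 0 ^ a * X 1 ^ b * (X 0 - X 1) ^ c : MvPolynomial (Fin 2) k)) := by
  intro n h hh
  obtain ⟨h, rfl⟩ := mem_multiples.1 hh
  rw [wittOp_mul]
  exact mem_multiples.2 (dvd_mul_right _ _)

/-- The polynomials `q` such that a stable subspace contains the ideal
`(x ^ (4 + 2 m) * y ^ (4 + 2 m) * (x - y) ^ (8 + m) * q)` for some `m`. -/
def conductor (N : Submodule k (MvPolynomial (Fin 2) k)) : Ideal (MvPolynomial (Fin 2) k) where
  carrier := {q | ∃ m, ∀ h,
    X 0 ^ (4 + 2 * m) * X 1 ^ (4 + 2 * m) * (X 0 - X 1) ^ (8 + m) * (h * q) ∈ N}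
  zero_mem' := ⟨0, fun h => by simp⟩
  add_mem' := by
    rintro p q ⟨m, hm⟩ ⟨l, hl⟩
    refine ⟨m + l, fun h => ?_⟩
    have h1 := hm (X 0 ^ (2 * l) * X 1 ^ (2 * l) * (X 0 - X 1) ^ l * h)
    have h2 := hl (X 0 ^ (2 * m) * X 1 ^ (2 * m) * (X 0 - X 1) ^ m * h)
    convert N.add_mem h1 h2 using 1
    ring
  smul_mem' := by
    rintro t q ⟨m, hm⟩
    refine ⟨m, fun h => ?_⟩
    convert hm (h * t) using 2
    rw [smul_eq_mul, mul_assoc]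

theorem IsStable.pderiv_mem_conductor {N : Submodule k (MvPolynomial (Fin 2) k)}
    (hN : IsStable N) (i : Fin 2) {q : MvPolynomial (Fin 2) k} (hq : q ∈ conductor N) :
    pderiv i q ∈ conductor N := by
  obtain ⟨m, hm⟩ := hq
  refine ⟨m + 1, fun h => ?_⟩
  have hW : ∀ n t, X 0 ^ (4 + 2 * m) * X 1 ^ (4 + 2 * m) * (X 0 - X 1) ^ (8 + m) *
      (X 0 ^ (n + 2) * pderiv 0 (t * q) + X 1 ^ (n + 2) * pderiv 1 (t * q)) ∈ N := by
    intro n t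
    have h1 := hN n _ (hm t)
    rw [wittOp_mul] at h1
    convert N.sub_mem h1 (hm (twist (4 + 2 * m) (4 + 2 * m) (8 + m) n * t)) using 1
    ring
  have hV : ∀ n t r, X 0 ^ (4 + 2 * m) * X 1 ^ (4 + 2 * m) * (X 0 - X 1) ^ (8 + m) *
      (t * (X 0 ^ (n + 2) * pderiv 0 q + X 1 ^ (n + 2) * pderiv 1 q) + r * q) ∈ N := by
    intro n t r
    convert N.add_mem (hW n t) (hm (r - X 0 ^ (n + 2) * pderiv 0 t - X 1 ^ (n + 2) * pderiv 1 t))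
      using 1
    simp only [Derivation.leibniz, smul_eq_mul]
    ring
  fin_cases i
  · convert N.sub_mem (hV 1 (X 1 ^ 2 * h) 0) (hV 0 (X 1 ^ 3 * h) 0) using 1
    simp only [Fin.zero_eta]
    ring
  · convert N.sub_mem (hV 0 (X 0 ^ 3 * h) 0) (hV 1 (X 0 ^ 2 * h) 0) using 1
    simp only [Fin.mk_one]
    ring

/-- A stable subspace that contains all antisymmetric polynomials and a nonzero symmetric one
contains an ideal `(x ^ a * y ^ b * (x - y) ^ c)`. -/
theorem IsStable.exists_multiples_le [CharZero k] {N : Submodule k (MvPolynomial (Fin 2) k)}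
    (hN : IsStable N) (hanti : ∀ h, h - swapVars h ∈ N) {q : MvPolynomial (Fin 2) k}
    (hq : q ∈ N) (hsymm : swapVars q = q) (hq0 : q ≠ 0) :
    ∃ a b c : ℕ, multiples (X 0 ^ a * X 1 ^ b * (X 0 - X 1) ^ c) ≤ N := by
  have hmem : q ∈ conductor N := ⟨0, fun h => by
    simpa [mul_assoc] using hN.mul_mem_of_symmetric hanti hq hsymm h⟩
  obtain ⟨m, hm⟩ := one_mem_of_pderiv_mem (conductor N)
    (fun i q hq => hN.pderiv_mem_conductor i hq) hmem hq0
  refine ⟨4 + 2 * m, 4 + 2 * m, 8 + m, fun p hp => ?_⟩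
  obtain ⟨h, rfl⟩ := mem_multiples.1 hp
  simpa using hm h

theorem dvd_sub_section_apply {l : MvPolynomial (Fin 2) k}
    (ρ : MvPolynomial (Fin 2) k →ₐ[k] Polynomial k) (s : Polynomial k →ₐ[k] MvPolynomial (Fin 2) k)
    (hl : ∀ i, l ∣ X i - s (ρ (X i))) (h : MvPolynomial (Fin 2) k) : l ∣ h - s (ρ h) := by
  have : (Ideal.Quotient.mkₐ k (Ideal.span {l})) =
      (Ideal.Quotient.mkₐ k (Ideal.span {l})).comp (s.comp ρ) := by
    apply algHom_ext
    intro i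
    exact Ideal.Quotient.eq.2 (Ideal.mem_span_singleton.2 (hl i))
  exact Ideal.mem_span_singleton.1 (Ideal.Quotient.eq.1 (congrArg (fun F => F h) this))

/-- If the operators act on `(g) / (g * l)`, identified with `k[t]`, as first-order
operators with nonvanishing symbols in high degree, stable subspaces strictly above `(g * l)` have
finite codimension in `(g)`. -/
theorem IsStable.exists_finiteDimensional {g l : MvPolynomial (Fin 2) k}
    (ρ : MvPolynomial (Fin 2) k →ₐ[k] Polynomial k) (s : Polynomial k →ₐ[k] MvPolynomial (Fin 2) k)
    (hs : ∀ r, ρ (s r) = r) (hl : ∀ i, l ∣ X i - s (ρ (X i)))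
    (κ : ℕ → k) (hκ : ∀ d : ℕ, ∃ m, ∀ n ≥ m, (d : k) + κ n ≠ 0)
    (T : ℕ → MvPolynomial (Fin 2) k → MvPolynomial (Fin 2) k)
    (hg : ∀ n h, wittOp n (g * h) = g * T n h)
    (hT : ∀ n h, ρ (T n h) = Polynomial.X ^ (n + 2) * Polynomial.derivative (ρ h)
      + Polynomial.C (κ n) * Polynomial.X ^ (n + 1) * ρ h)
    {N : Submodule k (MvPolynomial (Fin 2) k)} (hN : IsStable N)
    (hle : multiples (g * l) ≤ N) (hle' : N ≤ multiples g) (hne : ¬ N ≤ multiples (g * l)) :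
    ∃ F : Submodule k (MvPolynomial (Fin 2) k),
      FiniteDimensional k F ∧ F ≤ multiples g ∧ multiples g ≤ N ⊔ F := by
  let V : Submodule k (Polynomial k) := (N.comap (LinearMap.mulLeft k g)).map ρ.toLinearMap
  have hV : ∀ n, ∀ v ∈ V, Polynomial.X ^ (n + 2) * Polynomial.derivative v
      + Polynomial.C (κ n) * Polynomial.X ^ (n + 1) * v ∈ V := by
    rintro n _ ⟨h, hh, rfl⟩
    refine ⟨T n h, ?_, hT n h⟩
    change g * T n h ∈ N
    rw [← hg]
    exact hN n _ hh
  obtain ⟨p, hp, hp'⟩ := SetLike.not_le_iff_exists.1 hne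
  obtain ⟨h, rfl⟩ := mem_multiples.1 (hle' hp)
  have hρ : ρ h ≠ 0 := by
    intro h0
    have := dvd_sub_section_apply ρ s hl h
    rw [h0, map_zero, sub_zero] at this
    exact hp' (mem_multiples.2 (mul_dvd_mul_left g this))
  obtain ⟨D, hD⟩ := exists_sup_degreeLT_eq_top κ hκ V hV (v := ρ h) ⟨h, hp, rfl⟩ hρ
  refine ⟨(Polynomial.degreeLT k D).map (LinearMap.mulLeft k g ∘ₗ s.toLinearMap), ?_, ?_, ?_⟩
  · have : FiniteDimensional k (Polynomial.degreeLT k D) :=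
      Module.Finite.equiv (Polynomial.degreeLTEquiv k D).symm
    infer_instance
  · rintro _ ⟨r, -, rfl⟩
    exact mem_multiples.2 (dvd_mul_right _ _)
  · intro q hq
    obtain ⟨u, rfl⟩ := mem_multiples.1 hq
    have hu : ρ u ∈ V ⊔ Polynomial.degreeLT k D := by rw [hD]; trivial
    obtain ⟨_, ⟨w, hw, rfl⟩, r, hr, hsum⟩ := Submodule.mem_sup.1 hu
    have hdvd : l ∣ u - w - s r := by
      have h1 := dvd_sub_section_apply ρ s hl (u - w - s r)
      have h2 : ρ (u - w - s r) = 0 := by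
        rw [map_sub, map_sub, hs, ← hsum]
        simp
      rwa [h2, map_zero, sub_zero] at h1
    have h3 : g * (u - w - s r) ∈ N := hle (mem_multiples.2 (mul_dvd_mul_left g hdvd))
    have h4 : g * u = (g * (u - w - s r) + g * w) + g * s r := by ring
    rw [h4]
    exact Submodule.add_mem_sup (N.add_mem h3 hw) ⟨r, hr, rfl⟩

/-- The ascending chain condition for stable subspaces modulo the ideal `(g)`. -/
def StabilizesMod (g : MvPolynomial (Fin 2) k) : Prop :=
  ∀ N : ℕ →o Submodule k (MvPolynomial (Fin 2) k), (∀ m, IsStable (N m)) →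
    ∃ n, ∀ m ≥ n, N n ⊔ multiples g = N m ⊔ multiples g

theorem StabilizesMod.mul {g l : MvPolynomial (Fin 2) k} (hS : StabilizesMod g)
    (hg : IsStable (multiples g)) (hgl : IsStable (multiples (g * l)))
    (hfin : ∀ N, IsStable N → multiples (g * l) ≤ N → N ≤ multiples g →
      ¬ N ≤ multiples (g * l) → ∃ F : Submodule k (MvPolynomial (Fin 2) k),
        FiniteDimensional k F ∧ F ≤ multiples g ∧ multiples g ≤ N ⊔ F) :
    StabilizesMod (g * l) := by
  intro N hN
  have hglg : multiples (g * l) ≤ multiples g := fun p hp =>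
    mem_multiples.2 ((dvd_mul_right g l).trans (mem_multiples.1 hp))
  have hrow : ∃ n, ∀ m ≥ n, (N m ⊔ multiples (g * l)) ⊓ multiples g ≤
      (N n ⊔ multiples (g * l)) ⊓ multiples g := by
    let K : ℕ → Submodule k (MvPolynomial (Fin 2) k) :=
      fun m => (N m ⊔ multiples (g * l)) ⊓ multiples g
    have hK : Monotone K := fun i j hij => inf_le_inf_right _ (sup_le_sup_right (N.mono hij) _)
    have hKle : ∀ m, multiples (g * l) ≤ K m := fun m => le_inf le_sup_right hglg
    change ∃ n, ∀ m ≥ n, K m ≤ K n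
    by_cases hall : ∀ m, K m ≤ multiples (g * l)
    · exact ⟨0, fun m _ => (hall m).trans (hKle 0)⟩
    · push Not at hall
      obtain ⟨i, hi⟩ := hall
      obtain ⟨F, hF, hFg, hgF⟩ := hfin (K i) (((hN i).sup hgl).inf hg) (hKle i) inf_le_right hi
      obtain ⟨n, hn⟩ := monotone_stabilizes_iff_noetherian.2 (inferInstance : IsNoetherian k F)
        ⟨fun m => (K m).comap F.subtype, fun a b hab => Submodule.comap_mono (hK hab)⟩
      refine ⟨max i n, fun m hm => ?_⟩
      refine le_of_eq (eq_of_le_of_inf_le_of_sup_le (hK hm) (z := F) ?_ ?_).symm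
      · rintro p ⟨hp, hpF⟩
        have h1 := (hn m (le_of_max_le_right hm)).symm.le
        have h2 : (⟨p, hpF⟩ : F) ∈ (K n).comap F.subtype := h1 hp
        exact ⟨hK (le_max_right i n) h2, hpF⟩
      · refine (sup_le inf_le_right hFg).trans (hgF.trans ?_)
        exact sup_le_sup_right (hK (le_max_left i n)) F
  obtain ⟨a, ha⟩ := hrow
  obtain ⟨b, hb⟩ := hS N hN
  refine ⟨max a b, fun m hm => ?_⟩
  have hmono : ∀ {i j}, i ≤ j → N i ⊔ multiples (g * l) ≤ N j ⊔ multiples (g * l) :=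
    fun hij => sup_le_sup_right (N.mono hij) _
  refine eq_of_le_of_inf_le_of_sup_le (hmono hm) (z := multiples g) ?_ ?_
  · exact (ha m (le_of_max_le_left hm)).trans (inf_le_inf_right _ (hmono (le_max_left a b)))
  · rw [sup_assoc, sup_assoc, sup_eq_right.2 hglg, ← hb m (le_of_max_le_right hm)]
    exact sup_le_sup_right (N.mono (le_max_right a b)) _

theorem derivative_aeval_pair (u v : Polynomial k) (h : MvPolynomial (Fin 2) k) :
    Polynomial.derivative (aeval ![u, v] h) =
      aeval ![u, v] (pderiv 0 h) * Polynomial.derivative u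
        + aeval ![u, v] (pderiv 1 h) * Polynomial.derivative v := by
  induction h using MvPolynomial.induction_on with
  | C a => simp
  | add p q hp hq => simp only [map_add, hp, hq]; ring
  | mul_X p i hp =>
    fin_cases i <;>
    · simp only [map_mul, Polynomial.derivative_mul, hp, Derivation.leibniz, smul_eq_mul, map_add,
        Fin.zero_eta, Fin.mk_one, pderiv_X_self, pderiv_zero_X_one, pderiv_one_X_zero, aeval_X,
        Matrix.cons_val_zero, Matrix.cons_val_one, mul_one, mul_zero, zero_add]
      ring

section CharZero

variable [CharZero k]

theorem StabilizesMod.mul_X_zero {a b c : ℕ}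
    (h : StabilizesMod (X 0 ^ a * X 1 ^ b * (X 0 - X 1) ^ c : MvPolynomial (Fin 2) k)) :
    StabilizesMod (X 0 ^ (a + 1) * X 1 ^ b * (X 0 - X 1) ^ c : MvPolynomial (Fin 2) k) := by
  have hmul : (X 0 ^ (a + 1) * X 1 ^ b * (X 0 - X 1) ^ c : MvPolynomial (Fin 2) k) =
      X 0 ^ a * X 1 ^ b * (X 0 - X 1) ^ c * X 0 := by ring
  have hst := isStable_multiples (k := k) (a + 1) b c
  rw [hmul] at hst ⊢
  refine h.mul (isStable_multiples a b c) hst fun N hN hle hle' hne => ?_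
  refine IsStable.exists_finiteDimensional (aeval ![0, Polynomial.X]) (Polynomial.aeval (X 1))
    (fun r => ?_) (fun i => ?_) (fun n => (b : k) + c - n) (fun d => ⟨d + b + c + 1, fun n hn => ?_⟩)
    _ (wittOp_mul a b c) (fun n h => ?_) hN hle hle' hne
  · rw [← Polynomial.aeval_algHom_apply]; simp
  · fin_cases i <;> simp
  · have : ((d + b + c - n : ℤ) : k) ≠ 0 := Int.cast_ne_zero.2 (by omega)
    push_cast at this
    convert this using 1
    ring
  · rw [derivative_aeval_pair]
    simp only [twist, map_add, map_sub, map_mul, map_pow, map_natCast, map_sum, aeval_X,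
      Matrix.cons_val_zero, Matrix.cons_val_one, Finset.sum_range_succ' _ (n + 1),
      Polynomial.derivative_X, Polynomial.derivative_zero, mul_zero, zero_mul, zero_add,
      mul_one, one_mul, pow_succ, pow_zero, tsub_zero, Finset.sum_const_zero]
    ring

theorem StabilizesMod.mul_X_one {a b c : ℕ}
    (h : StabilizesMod (X 0 ^ a * X 1 ^ b * (X 0 - X 1) ^ c : MvPolynomial (Fin 2) k)) :
    StabilizesMod (X 0 ^ a * X 1 ^ (b + 1) * (X 0 - X 1) ^ c : MvPolynomial (Fin 2) k) := by
  have hmul : (X 0 ^ a * X 1 ^ (b + 1) * (X 0 - X 1) ^ c : MvPolynomial (Fin 2) k) =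
      X 0 ^ a * X 1 ^ b * (X 0 - X 1) ^ c * X 1 := by ring
  have hst := isStable_multiples (k := k) a (b + 1) c
  rw [hmul] at hst ⊢
  refine h.mul (isStable_multiples a b c) hst fun N hN hle hle' hne => ?_
  refine IsStable.exists_finiteDimensional (aeval ![Polynomial.X, 0]) (Polynomial.aeval (X 0))
    (fun r => ?_) (fun i => ?_) (fun n => (a : k) + c - n) (fun d => ⟨d + a + c + 1, fun n hn => ?_⟩)
    _ (wittOp_mul a b c) (fun n h => ?_) hN hle hle' hne
  · rw [← Polynomial.aeval_algHom_apply]; simp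
  · fin_cases i <;> simp
  · have : ((d + a + c - n : ℤ) : k) ≠ 0 := Int.cast_ne_zero.2 (by omega)
    push_cast at this
    convert this using 1
    ring
  · rw [derivative_aeval_pair]
    have hsum : ∑ i ∈ Finset.range (n + 1), (Polynomial.X : Polynomial k) ^ i * 0 ^ (n + 1 - i)
        = 0 := by
      refine Finset.sum_eq_zero fun i hi => ?_
      have := Finset.mem_range.1 hi
      rw [zero_pow (by omega), mul_zero]
    simp only [twist, map_add, map_sub, map_mul, map_pow, map_natCast, map_sum, aeval_X,
      Matrix.cons_val_zero, Matrix.cons_val_one, Finset.sum_range_succ _ (n + 1), hsum,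
      Polynomial.derivative_X, Polynomial.derivative_zero, mul_zero, zero_mul, add_zero, zero_add,
      mul_one, pow_succ, pow_zero, tsub_self]
    ring

theorem StabilizesMod.mul_X_zero_sub_X_one {a b c : ℕ}
    (h : StabilizesMod (X 0 ^ a * X 1 ^ b * (X 0 - X 1) ^ c : MvPolynomial (Fin 2) k)) :
    StabilizesMod (X 0 ^ a * X 1 ^ b * (X 0 - X 1) ^ (c + 1) : MvPolynomial (Fin 2) k) := by
  have hmul : (X 0 ^ a * X 1 ^ b * (X 0 - X 1) ^ (c + 1) : MvPolynomial (Fin 2) k) =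
      X 0 ^ a * X 1 ^ b * (X 0 - X 1) ^ c * (X 0 - X 1) := by ring
  have hst := isStable_multiples (k := k) a b (c + 1)
  rw [hmul] at hst ⊢
  refine h.mul (isStable_multiples a b c) hst fun N hN hle hle' hne => ?_
  refine IsStable.exists_finiteDimensional (aeval ![Polynomial.X, Polynomial.X])
    (Polynomial.aeval (X 1)) (fun r => ?_) (fun i => ?_)
    (fun n => (a : k) + b + (n + 2) * c - 2 * n) (fun d => ⟨d + a + b + 3, fun n hn => ?_⟩)
    _ (wittOp_mul a b c) (fun n h => ?_) hN hle hle' hne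
  · rw [← Polynomial.aeval_algHom_apply]; simp
  · fin_cases i <;> simp
  · have : ((d + a + b + (n + 2) * c - 2 * n : ℤ) : k) ≠ 0 := by
      refine Int.cast_ne_zero.2 ?_
      rcases c with _ | _ | c
      · push_cast; omega
      · push_cast; omega
      · have : (0 : ℤ) ≤ n * c := by positivity
        push_cast
        intro h0
        nlinarith
    push_cast at this
    convert this using 1
    ring
  · rw [derivative_aeval_pair]
    have hsum : ∑ i ∈ Finset.range (n + 2),
        (Polynomial.X : Polynomial k) ^ i * Polynomial.X ^ (n + 1 - i) =
          (n + 2 : Polynomial k) * Polynomial.X ^ (n + 1) := by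
      rw [Finset.sum_congr rfl (g := fun _ => (Polynomial.X : Polynomial k) ^ (n + 1))]
      · simp
      · intro i hi
        have := Finset.mem_range.1 hi
        rw [← pow_add]
        congr 1
        omega
    simp only [twist, map_add, map_sub, map_mul, map_pow, map_natCast, map_sum, aeval_X,
      Matrix.cons_val_zero, Matrix.cons_val_one, hsum, map_ofNat, Polynomial.derivative_X, mul_one]
    ring

theorem stabilizesMod (a b c : ℕ) :
    StabilizesMod (X 0 ^ a * X 1 ^ b * (X 0 - X 1) ^ c : MvPolynomial (Fin 2) k) := by
  induction a with
  | succ a ih => exact ih.mul_X_zero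
  | zero =>
    induction b with
    | succ b ih => exact ih.mul_X_one
    | zero =>
      induction c with
      | succ c ih => exact ih.mul_X_zero_sub_X_one
      | zero =>
        intro N _
        have : multiples (X 0 ^ 0 * X 1 ^ 0 * (X 0 - X 1) ^ 0 : MvPolynomial (Fin 2) k) = ⊤ :=
          eq_top_iff.2 fun p _ => mem_multiples.2 (by simp)
        exact ⟨0, fun m _ => by rw [this, sup_top_eq, sup_top_eq]⟩

/-- The ascending chain condition for stable subspaces containing all antisymmetric polynomials. -/
theorem exists_chain_stable (N : ℕ →o Submodule k (MvPolynomial (Fin 2) k))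
    (hN : ∀ m, IsStable (N m)) (hanti : ∀ m h, h - swapVars h ∈ N m) :
    ∃ n, ∀ m ≥ n, N n = N m := by
  by_cases hex : ∃ i, ∃ q ∈ N i, swapVars q = q ∧ q ≠ 0
  · obtain ⟨i, q, hq, hsymm, hq0⟩ := hex
    obtain ⟨a, b, c, hle⟩ := (hN i).exists_multiples_le (hanti i) hq hsymm hq0
    obtain ⟨n, hn⟩ := stabilizesMod a b c N hN
    have hsup : ∀ j ≥ i, N j ⊔ multiples (X 0 ^ a * X 1 ^ b * (X 0 - X 1) ^ c) = N j :=
      fun j hj => sup_eq_left.2 (hle.trans (N.mono hj))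
    refine ⟨max i n, fun m hm => ?_⟩
    rw [← hsup _ (le_max_left i n), ← hsup m (le_of_max_le_left hm), ← hn _ (le_max_right i n),
      hn m (le_of_max_le_right hm)]
  · push Not at hex
    refine ⟨0, fun m _ => le_antisymm (N.mono (Nat.zero_le m)) fun q hq => ?_⟩
    have h1 : swapVars q ∈ N m := by
      simpa using (N m).sub_mem hq (hanti m q)
    have h2 : q + swapVars q = 0 := hex m _ ((N m).add_mem hq h1) (by simp [add_comm])
    have h3 := hanti 0 ((2⁻¹ : k) • q)
    rwa [map_smul, ← smul_sub, eq_neg_of_add_eq_zero_right h2, sub_neg_eq_add,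
      half_smul_add_self] at h3

end CharZero

open PositiveWitt SymmetricAlgebra

theorem ι_mul_ι_mem_symPow (x y : PositiveWitt k) :
    ι k (PositiveWitt k) x * ι k (PositiveWitt k) y ∈ symPow k (PositiveWitt k) 2 := by
  change _ ∈ LinearMap.range (ι k (PositiveWitt k)) ^ 2
  rw [pow_two]
  exact Submodule.mul_mem_mul ⟨x, rfl⟩ ⟨y, rfl⟩

/-- The linear map `k[x, y] → S²(W₊)` with `x ^ a * y ^ b ↦ e (a + 1) * e (b + 1)`. -/
def toSymPow : MvPolynomial (Fin 2) k →ₗ[k] symPow k (PositiveWitt k) 2 :=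
  (basisMonomials (Fin 2) k).constr k fun u =>
    ⟨ι k (PositiveWitt k) (e (u 0).succPNat) * ι k (PositiveWitt k) (e (u 1).succPNat),
      ι_mul_ι_mem_symPow _ _⟩

theorem toSymPow_monomial (u : Fin 2 →₀ ℕ) :
    (toSymPow (monomial u (1 : k)) : SymmetricAlgebra k (PositiveWitt k)) =
      ι k (PositiveWitt k) (e (u 0).succPNat) * ι k (PositiveWitt k) (e (u 1).succPNat) := by
  have h : basisMonomials (Fin 2) k u = monomial u 1 := congrFun (coe_basisMonomials _ _) u
  rw [toSymPow, ← h, Module.Basis.constr_basis]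

theorem toSymPow_X_pow_mul_X_pow (a b : ℕ) :
    (toSymPow (X 0 ^ a * X 1 ^ b : MvPolynomial (Fin 2) k) :
        SymmetricAlgebra k (PositiveWitt k)) =
      ι k (PositiveWitt k) (e a.succPNat) * ι k (PositiveWitt k) (e b.succPNat) := by
  have := toSymPow_monomial (k := k) (Finsupp.single 0 a + Finsupp.single 1 b)
  rw [monomial_eq_smul_X_pow, one_smul] at this
  simpa using this

/-- It suffices to check linear identities on the monomials `x ^ a * y ^ b`. -/
theorem induction_X_pow_mul_X_pow {p : MvPolynomial (Fin 2) k → Prop}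
    (h : MvPolynomial (Fin 2) k) (mon : ∀ a b, p (X 0 ^ a * X 1 ^ b))
    (add : ∀ f g, p f → p g → p (f + g)) (smul : ∀ (t : k) f, p f → p (t • f)) : p h := by
  induction h using MvPolynomial.induction_on' with
  | monomial u a => rw [monomial_eq_smul_X_pow]; exact smul _ _ (mon _ _)
  | add f g hf hg => exact add _ _ hf hg

theorem toSymPow_swapVars (h : MvPolynomial (Fin 2) k) :
    toSymPow (swapVars h) = toSymPow h := by
  induction h using induction_X_pow_mul_X_pow with
  | mon a b =>
    apply Subtype.ext
    rw [map_mul, map_pow, map_pow, swapVars_X_zero, swapVars_X_one, mul_comm,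
      toSymPow_X_pow_mul_X_pow, toSymPow_X_pow_mul_X_pow, mul_comm]
  | add f g hf hg => rw [map_add, map_add, map_add, hf, hg]
  | smul t f hf => rw [map_smul, map_smul, map_smul, hf]

theorem wittOp_X_pow_mul_X_pow (n a b : ℕ) :
    wittOp n (X 0 ^ a * X 1 ^ b : MvPolynomial (Fin 2) k) =
      ((a : k) - n) • (X 0 ^ (n + a + 1) * X 1 ^ b) +
        ((b : k) - n) • (X 0 ^ a * X 1 ^ (n + b + 1)) := by
  have hx := X_mul_pderiv_X_pow (k := k) (0 : Fin 2) a
  have hy := X_mul_pderiv_X_pow (k := k) (1 : Fin 2) b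
  have hxn := X_mul_pderiv_X_pow (k := k) (0 : Fin 2) n
  have hyn := X_mul_pderiv_X_pow (k := k) (1 : Fin 2) n
  simp only [wittOp, Derivation.leibniz, smul_eq_mul, pderiv_zero_X_one_pow,
    pderiv_one_X_zero_pow, mul_zero, add_zero, zero_add, smul_eq_C_mul, map_sub, map_natCast]
  linear_combination X 0 ^ (n + 1) * X 1 ^ b * hx + X 1 ^ (n + 1) * X 0 ^ a * hy
    - X 0 * X 0 ^ a * X 1 ^ b * hxn - X 1 * X 0 ^ a * X 1 ^ b * hyn

theorem toSymPow_wittOp (n : ℕ) (h : MvPolynomial (Fin 2) k) :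
    toSymPow (wittOp n h) = ⁅(e n.succPNat : PositiveWitt k), toSymPow h⁆ := by
  induction h using induction_X_pow_mul_X_pow with
  | mon a b =>
    apply Subtype.ext
    have hsucc : ∀ m : ℕ, n.succPNat + m.succPNat = (n + m + 1).succPNat := by
      intro m
      apply PNat.eq
      simp only [PNat.add_coe, Nat.succPNat_coe]
      omega
    rw [wittOp_X_pow_mul_X_pow, map_add, map_smul, map_smul, LieSubmodule.coe_bracket,
      Submodule.coe_add, Submodule.coe_smul, Submodule.coe_smul, toSymPow_X_pow_mul_X_pow,
      toSymPow_X_pow_mul_X_pow, toSymPow_X_pow_mul_X_pow, lie_mul, lie_ι, lie_ι, lie_e_e, lie_e_e,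
      hsucc, hsucc, map_smul, map_smul, mul_smul_comm, mul_smul_comm, add_comm]
    simp only [Nat.succPNat_coe, Nat.cast_succ, add_sub_add_right_eq_sub]
    congr 2
    exact mul_comm _ _
  | add f g hf hg => rw [wittOp_add, map_add, hf, hg, map_add, lie_add]
  | smul t f hf => rw [wittOp_smul, map_smul, hf, map_smul, lie_smul]

theorem toSymPow_surjective : Function.Surjective (toSymPow (k := k)) := by
  have hle : LinearMap.range (ι k (PositiveWitt k)) ^ 2 ≤
      LinearMap.range ((symPow k (PositiveWitt k) 2).toSubmodule.subtype ∘ₗ toSymPow) := by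
    have hι : LinearMap.range (ι k (PositiveWitt k)) =
        Submodule.span k (Set.range fun i => ι k (PositiveWitt k) (e i)) := by
      rw [LinearMap.range_eq_map, ← e.span_eq, Submodule.map_span, ← Set.range_comp]
      rfl
    rw [pow_two, hι, Submodule.span_mul_span, Submodule.span_le]
    rintro _ ⟨_, ⟨i, rfl⟩, _, ⟨j, rfl⟩, rfl⟩
    refine ⟨X 0 ^ i.natPred * X 1 ^ j.natPred, ?_⟩
    rw [LinearMap.comp_apply]
    refine (toSymPow_X_pow_mul_X_pow _ _).trans ?_
    rw [PNat.succPNat_natPred, PNat.succPNat_natPred]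
  rintro ⟨p, hp⟩
  obtain ⟨h, hh⟩ := hle hp
  exact ⟨h, Subtype.ext hh⟩

end WittPoly

end

theorem theorem4p2 (k : Type*) [Field k] [CharZero k] :
    WellFoundedGT (LieSubmodule k (PositiveWitt k)
      (SymmetricAlgebra.symPow k (PositiveWitt k) 2)) := by
  rw [wellFoundedGT_iff_monotone_chain_condition]
  intro N
  obtain ⟨n, hn⟩ := WittPoly.exists_chain_stable (k := k)
    ⟨fun m => (N m).toSubmodule.comap WittPoly.toSymPow,
      fun i j hij => Submodule.comap_mono (N.mono hij)⟩
    (fun m i h hh => by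
      change WittPoly.toSymPow (WittPoly.wittOp i h) ∈ N m
      rw [WittPoly.toSymPow_wittOp]
      exact (N m).lie_mem hh)
    (fun m h => by
      change WittPoly.toSymPow (h - WittPoly.swapVars h) ∈ N m
      rw [map_sub, WittPoly.toSymPow_swapVars, sub_self]
      exact (N m).zero_mem)
  refine ⟨n, fun m hm => ?_⟩
  rw [← LieSubmodule.toSubmodule_inj]
  exact Submodule.comap_injective_of_surjective WittPoly.toSymPow_surjective (hn m hm)
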